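/- **Theorem (quantum singular value transformation with real polynomials).** Notation: an $n$-qubit matrix is a matrix in $\mathbb{C}^{2^n\times 2^n}$. A unitary $U$ on $m+n$ qubits is a $(1,m)$-block-encoding of an $n$-qubit matrix $A$ if $(\langle 0^m|\otimes I_n)\,U\,(|0^m\rangle\otimes I_n)=A$. If $A=W\Sigma V^\dagger$ is a singular value decomposition ($W,V$ unitary, $\Sigma=\operatorname{diag}(\sigma_i)$ with $\sigma_i\ge 0$) and $f:\mathbb{R}\to\mathbb{C}$, put $f(\Sigma)=\operatorname{diag}(f(\sigma_i))$, $f^{\diamond}(A)=Wf(\Sigma)V^\dagger$ and $f^{\triangleright}(A)=Vf(\Sigma)V^\dagger$. On one signal qubit, $m$ ancilla qubits and $n$ system qubits, let $C$ be the gate that applies NOT to the signal qubit if and only if the $m$ ancilla qubits are in state $0^m$ (the $m$-qubit controlled NOT), let $\mathrm{CR}_\phi = C\,(e^{-\mathrm{i}\phi Z}\otimes I)\,C$ with the single-qubit rotation acting on the signal qubit, and let $H$ be the Hadamard gate on the signal qubit. For $\Phi=(\phi_0,\dots,\phi_d)\in\mathbb{R}^{d+1}$ and a unitary $U_A$ on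 the ancilla and system qubits, let $U_\Phi$ be the circuit that applies, in this order in time, $$H,\ \mathrm{CR}_{\phi_d},\ U_A,\ \mathrm{CR}_{\phi_{d-1}},\ U_A^\dagger,\ \mathrm{CR}_{\phi_{d-2}},\ U_A,\ \dots,\ \mathrm{CR}_{\phi_0},\ H,$$ with $d$ alternating uses of $U_A$ and $U_A^\dagger$ starting with $U_A$ (so the last one is $U_A$ if $d$ is odd and $U_A^\dagger$ if $d$ is even). There is an absolute constant $c$ such that the following holds. Let $A$ be an $n$-qubit matrix and let $U_A$ be a $(1,m)$-block-encoding of $A$. Let $P_{\Re}\in\mathbb{R}[x]$ be a polynomial of degree $d>0$ such that $P_{\Re}(-x)=(-1)^dP_{\Re}(x)$ and $|P_{\Re}(x)|\le 1$ for all $x\in[-1,1]$. Then there are phase factors $\Phi\in\mathbb{R}^{d+1}$ such that $U_\Phi$, with the signal qubit counted as an additional ancilla qubit, is a $(1,m+1)$-block-encoding of $P_{\Re}^{\diamond}(A)$ if $d$ is odd and of $P_{\Re}^{\triangleright}(A)$ if $d$ is even (for every singular value decomposition of $A$). The circuit $U_\Phi$ consists of at most $c\,d$ gates, each of which is $U_A$,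 $U_A^\dagger$, the $m$-qubit controlled NOT, a single-qubit rotation $e^{-\mathrm{i}\phi Z}$, or $H$. -/

import Mathlib

open scoped Matrix Kronecker

noncomputable section

namespace QSVT

/-! ### Singular value decompositions and generalized matrix functions -/

/-- A singular value decomposition `A = W Σ V†` of a square matrix: `W`, `V` are unitary and
`Σ = diag(σ)` with `σ i ≥ 0` (no ordering of the singular values is imposed). -/
structure SVD {ι : Type*} [Fintype ι] [DecidableEq ι] (A : Matrix ι ι ℂ) where
  W : Matrix ι ι ℂ
  V : Matrix ι ι ℂ
  σ : ι → ℝ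
  W_unitary : W ∈ Matrix.unitaryGroup ι ℂ
  V_unitary : V ∈ Matrix.unitaryGroup ι ℂ
  σ_nonneg : ∀ i, 0 ≤ σ i
  eq_mul : A = W * Matrix.diagonal (fun i => (σ i : ℂ)) * Vᴴ

namespace SVD

variable {ι : Type*} [Fintype ι] [DecidableEq ι] {A : Matrix ι ι ℂ}

/-- The generalized matrix function `f^⋄(A) = W f(Σ) V†`. -/
def diamond (D : SVD A) (f : ℝ → ℂ) : Matrix ι ι ℂ :=
  D.W * Matrix.diagonal (fun i => f (D.σ i)) * D.Vᴴ

/-- The right generalized matrix function `f^▷(A) = V f(Σ) V†`. -/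
def right (D : SVD A) (f : ℝ → ℂ) : Matrix ι ι ℂ :=
  D.V * Matrix.diagonal (fun i => f (D.σ i)) * D.Vᴴ

/-- Every square complex matrix has a singular value decomposition. -/
theorem nonempty {ι : Type*} [Fintype ι] [DecidableEq ι] (A : Matrix ι ι ℂ) :
    Nonempty (SVD A) := by
  have hH : (Aᴴ * A).IsHermitian := Matrix.isHermitian_conjTranspose_mul_self A
  set V : Matrix ι ι ℂ := (hH.eigenvectorUnitary : Matrix ι ι ℂ) with hV
  have hVu : V ∈ Matrix.unitaryGroup ι ℂ := hH.eigenvectorUnitary.2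
  have hVV : Vᴴ * V = 1 := Matrix.mem_unitaryGroup_iff'.1 hVu
  have hVV' : V * Vᴴ = 1 := Matrix.mem_unitaryGroup_iff.1 hVu
  have hl : ∀ i, 0 ≤ hH.eigenvalues i := by
    open scoped ComplexOrder in
    exact (Matrix.posSemidef_conjTranspose_mul_self A).eigenvalues_nonneg
  have hB : (A * V)ᴴ * (A * V) = Matrix.diagonal (fun i => (hH.eigenvalues i : ℂ)) := by
    have h := hH.spectral_theorem
    rw [Unitary.conjStarAlgAut_apply] at h
    have h2 : Aᴴ * A = V * Matrix.diagonal (fun i => (hH.eigenvalues i : ℂ)) * Vᴴ := h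
    calc (A * V)ᴴ * (A * V) = Vᴴ * (Aᴴ * A) * V := by
          rw [Matrix.conjTranspose_mul]
          simp only [Matrix.mul_assoc]
      _ = Vᴴ * (V * Matrix.diagonal (fun i => (hH.eigenvalues i : ℂ)) * Vᴴ) * V :=
          congrArg (fun M => Vᴴ * M * V) h2
      _ = (Vᴴ * V) * Matrix.diagonal (fun i => (hH.eigenvalues i : ℂ)) * (Vᴴ * V) := by
          simp only [Matrix.mul_assoc]
      _ = _ := by rw [hVV, Matrix.one_mul, Matrix.mul_one]
  have hdot : ∀ i j, ∑ k, star ((A * V) k i) * (A * V) k j =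
      if i = j then (hH.eigenvalues i : ℂ) else 0 := by
    intro i j
    have := congrFun (congrFun hB i) j
    rw [Matrix.mul_apply, Matrix.diagonal_apply] at this
    exact this
  let σ : ι → ℝ := fun i => Real.sqrt (hH.eigenvalues i)
  have hσ : ∀ i, (σ i : ℂ) * σ i = hH.eigenvalues i := fun i => by
    rw [← Complex.ofReal_mul, Real.mul_self_sqrt (hl i)]
  let u : ι → EuclideanSpace ℂ ι := fun j =>
    WithLp.toLp 2 (fun k => (σ j : ℂ)⁻¹ * (A * V) k j)
  let s : Set ι := {j | σ j ≠ 0}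
  have hu : Orthonormal ℂ (s.domRestrict u) := by
    rw [orthonormal_iff_ite]
    rintro ⟨i, hi⟩ ⟨j, hj⟩
    have hi' : (σ i : ℂ) ≠ 0 := by exact_mod_cast hi
    have : inner ℂ (u i) (u j) = (σ i : ℂ)⁻¹ * (σ j : ℂ)⁻¹ *
        ∑ k, star ((A * V) k i) * (A * V) k j := by
      simp only [u, PiLp.inner_apply, RCLike.inner_apply, Finset.mul_sum]
      refine Finset.sum_congr rfl fun k _ => ?_
      simp
      ring
    simp only [Set.domRestrict_apply, Subtype.mk.injEq]
    rw [this, hdot]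
    split_ifs with h
    · subst h
      rw [← hσ i]
      field_simp
    · simp
  obtain ⟨b, hb⟩ := hu.exists_orthonormalBasis_extension_of_card_eq (by simp)
  let W : Matrix ι ι ℂ := Matrix.of fun k j => b j k
  have hW : W ∈ Matrix.unitaryGroup ι ℂ := by
    rw [Matrix.mem_unitaryGroup_iff']
    ext i j
    have h := orthonormal_iff_ite.1 b.orthonormal i j
    simp only [PiLp.inner_apply, RCLike.inner_apply] at h
    simp only [Matrix.mul_apply, Matrix.star_apply, W, Matrix.of_apply, Matrix.one_apply]
    rw [← h]
    exact Finset.sum_congr rfl fun k _ => mul_comm _ _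
  have hWB : W * Matrix.diagonal (fun i => (σ i : ℂ)) = A * V := by
    ext k j
    rw [Matrix.mul_diagonal]
    by_cases hj : σ j = 0
    · have h0 := hdot j j
      rw [if_pos rfl, ← hσ j, hj] at h0
      have h1 : ∑ k, ‖(A * V) k j‖ ^ 2 = 0 := by
        have h2 : ((∑ k, ‖(A * V) k j‖ ^ 2 : ℝ) : ℂ) = 0 := by
          rw [Complex.ofReal_sum]
          simp only [Complex.ofReal_zero, mul_zero] at h0
          rw [← h0]
          refine Finset.sum_congr rfl fun k _ => ?_
          rw [Complex.ofReal_pow]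
          exact (Complex.conj_mul' _).symm
        exact_mod_cast h2
      have h3 := (Finset.sum_eq_zero_iff_of_nonneg (fun k _ => sq_nonneg _)).1 h1 k
        (Finset.mem_univ k)
      have h4 : (A * V) k j = 0 := by simpa using h3
      rw [h4, hj]
      simp
    · have hj' : (σ j : ℂ) ≠ 0 := by exact_mod_cast hj
      simp only [W, Matrix.of_apply, hb j hj, u]
      field_simp
  refine ⟨⟨W, V, σ, hW, hVu, fun i => Real.sqrt_nonneg _, ?_⟩⟩
  rw [hWB, Matrix.mul_assoc, hVV', Matrix.mul_one]

end SVD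

/-! ### Qubit registers and block encodings -/

/-- Labels of the computational basis of a register of `k` qubits; the string `0^k` is `0`. -/
abbrev Bits (k : ℕ) : Type := Fin k → Fin 2

/-- `U` is an (exact) `(α, m)`-block-encoding of the `n`-qubit matrix `A`: `U` is a unitary on
`m` ancilla qubits and `n` system qubits with `A = α (⟨0^m| ⊗ I) U (|0^m⟩ ⊗ I)`. -/
def IsBlockEncoding (α : ℝ) {m n : ℕ} (U : Matrix (Bits m × Bits n) (Bits m × Bits n) ℂ)
    (A : Matrix (Bits n) (Bits n) ℂ) : Prop :=
  U ∈ Matrix.unitaryGroup (Bits m × Bits n) ℂ ∧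
    A = (α : ℂ) • Matrix.of (fun i j : Bits n => U (0, i) (0, j))

/-! ### Circuits -/

/-- The elementary gates; they act on one signal qubit, `m` ancilla qubits and `n` system
qubits. -/
inductive Gate : Type
  /-- the Hadamard gate on the signal qubit -/
  | hadamard : Gate
  /-- the single-qubit rotation `exp(-i φ Z)` on the signal qubit -/
  | rotation (φ : ℝ) : Gate
  /-- the NOT gate on the signal qubit, controlled on the `m` ancilla qubits being `0^m` -/
  | controlledNot : Gate
  /-- `U_A` on the ancilla and system qubits -/
  | encoding : Gate
  /-- `U_A†` on the ancilla and system qubits -/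
  | encodingDagger : Gate

def hadamardMatrix : Matrix (Fin 2) (Fin 2) ℂ :=
  ((1 / Real.sqrt 2 : ℝ) : ℂ) • !![1, 1; 1, -1]

def pauliX : Matrix (Fin 2) (Fin 2) ℂ := !![0, 1; 1, 0]

/-- `exp(-i φ Z)`. -/
def rotationMatrix (φ : ℝ) : Matrix (Fin 2) (Fin 2) ℂ :=
  !![Complex.exp (-(Complex.I * φ)), 0; 0, Complex.exp (Complex.I * φ)]

/-- The projector `|0^m⟩⟨0^m| ⊗ I` on the ancilla and system registers. -/
def zeroProjector (m n : ℕ) : Matrix (Bits m × Bits n) (Bits m × Bits n) ℂ :=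
  Matrix.single 0 0 1 ⊗ₖ 1

/-- The unitary matrix of a gate, given `U_A`. -/
def Gate.toMatrix {m n : ℕ} (U : Matrix (Bits m × Bits n) (Bits m × Bits n) ℂ) :
    Gate → Matrix (Fin 2 × (Bits m × Bits n)) (Fin 2 × (Bits m × Bits n)) ℂ
  | .hadamard => hadamardMatrix ⊗ₖ 1
  | .rotation φ => rotationMatrix φ ⊗ₖ 1
  | .controlledNot => pauliX ⊗ₖ zeroProjector m n + 1 ⊗ₖ (1 - zeroProjector m n)
  | .encoding => 1 ⊗ₖ U
  | .encodingDagger => 1 ⊗ₖ Uᴴ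

/-- A circuit: the list of its gates in the order of time (the head is applied first). -/
abbrev Circuit : Type := List Gate

namespace Circuit

/-- The matrix of a circuit, the product of its gates, the first gate being rightmost. -/
def toMatrix {m n : ℕ} (U : Matrix (Bits m × Bits n) (Bits m × Bits n) ℂ) :
    Circuit → Matrix (Fin 2 × (Bits m × Bits n)) (Fin 2 × (Bits m × Bits n)) ℂ
  | [] => 1
  | g :: c => toMatrix U c * g.toMatrix U

/-- The signal qubit counted as the first of `m + 1` ancilla qubits. -/
def signalEquiv (m n : ℕ) : Fin 2 × (Bits m × Bits n) ≃ Bits (m + 1) × Bits n :=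
  (Equiv.prodAssoc _ _ _).symm.trans
    ((Fin.consEquiv (fun _ : Fin (m + 1) => Fin 2)).prodCongr (Equiv.refl _))

/-- The matrix of a circuit on `m + 1` ancilla qubits and `n` system qubits. -/
def unitary {m n : ℕ} (U : Matrix (Bits m × Bits n) (Bits m × Bits n) ℂ) (c : Circuit) :
    Matrix (Bits (m + 1) × Bits n) (Bits (m + 1) × Bits n) ℂ :=
  Matrix.reindex (signalEquiv m n) (signalEquiv m n) (toMatrix U c)

/-- The number of gates of a circuit. -/
def gateCount (c : Circuit) : ℕ := c.length

/-- The controlled rotation `CR_φ`. -/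
def controlledRotation (φ : ℝ) : Circuit :=
  [.controlledNot, .rotation φ, .controlledNot]

/-- The circuit `H, CR_{φ_d}, U_A, CR_{φ_{d-1}}, U_A†, CR_{φ_{d-2}}, U_A, …, CR_{φ_0}, H`
(in the order of time) with `d` alternating uses of `U_A` and `U_A†`. -/
def qsvt {d : ℕ} (Φ : Fin (d + 1) → ℝ) : Circuit :=
  [.hadamard] ++ controlledRotation (Φ (Fin.last d)) ++
    (List.finRange d).flatMap (fun j : Fin d =>
      (if Even (j : ℕ) then Gate.encoding else Gate.encodingDagger) ::
        controlledRotation (Φ j.rev.castSucc)) ++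
    [.hadamard]

end Circuit

end QSVT

end

/-! Let E be the isometry |0^m⟩ ⊗ I, and let A = W Σ V†. On each pair formed by an embedded singular
vector and the component outside the range of E of its partner's image, a use of U_A or U_A† acts as
the reflection [[σ, s], [s, -σ]] with s = √(1 - σ²), and a phase gate of E E† acts as exp(iφZ).
Alternating the two therefore transforms every σ by a polynomial, the first entry of `qspPair`
(`alternating_mul`). A controlled rotation applies opposite phases in the two signal states
(`toMatrix_controlledRotation`), opposite phases give conjugate polynomials (`qspPair_neg`), and the
Hadamard gates average the two branches, so that the real part of the polynomial remains.

It remains to find phases with prescribed real part P. Every pair with |F|² + (1 - x²)|Q|² = 1 and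
the right degrees and parities comes from phases: the identity forces top coefficients of equal
modulus, so one phase can be peeled off and the degree drops (`exists_phases`). With F = P + iB and
B, Q real, the requirement is 1 - P² = B² + (1 - x²)Q². As 1 - P² is a polynomial in y = x²,
nonnegative for y in [0, 1], this is a Markov–Lukács theorem (`hasLukacsForm_of_nonneg`), proved by
splitting off real factors, because such representations are multiplicative (`HasLukacsForm.mul`).
-/

namespace QSVT

open Polynomial

/-! ### Markov–Lukács representations on [0, 1] -/

/-- `f(x²) = B² + (1 - x²) C²`, where `B` has degree at most `d` and the parity of `d`, and
`C` has degree less than `d` and the opposite parity. -/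
def HasLukacsForm (d : ℕ) (f : ℝ[X]) : Prop :=
  ∃ B C : ℝ[X], B.natDegree ≤ d ∧ (X * C).natDegree ≤ d ∧
    B.comp (-X) = (-1) ^ d * B ∧ C.comp (-X) = -(-1) ^ d * C ∧
    f.comp (X ^ 2) = B ^ 2 + (1 - X ^ 2) * C ^ 2

theorem natDegree_le_of_X_mul {R : Type*} [Semiring R] [Nontrivial R] {C : R[X]} {d : ℕ}
    (h : (X * C).natDegree ≤ d) : C.natDegree ≤ d := by
  by_cases hC : C = 0
  · simp [hC]
  · rw [natDegree_X_mul hC] at h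
    omega

/-- With s = √(1 - x²), the form is |B + isC|², and the modulus is multiplicative: the new pair is
read off (B + isC)(B' + isC'). -/
theorem HasLukacsForm.mul {d e : ℕ} {f g : ℝ[X]} (hf : HasLukacsForm d f)
    (hg : HasLukacsForm e g) : HasLukacsForm (d + e) (f * g) := by
  obtain ⟨B, C, hB, hC, pB, pC, hf⟩ := hf
  obtain ⟨B', C', hB', hC', pB', pC', hg⟩ := hg
  refine ⟨B * B' - (1 - X ^ 2) * C * C', B * C' + B' * C, ?_, ?_, ?_, ?_, ?_⟩
  · have : B * B' - (1 - X ^ 2) * C * C' = B * B' - (C * C' - (X * C) * (X * C')) := by ring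
    rw [this]
    exact natDegree_sub_le_of_le (natDegree_mul_le_of_le hB hB')
      (natDegree_sub_le_of_le
        (natDegree_mul_le_of_le (natDegree_le_of_X_mul hC) (natDegree_le_of_X_mul hC'))
        (natDegree_mul_le_of_le hC hC')) |>.trans (by simp)
  · have : X * (B * C' + B' * C) = B * (X * C') + (X * C) * B' := by ring
    rw [this]
    exact (natDegree_add_le_of_le (natDegree_mul_le_of_le hB hC')
      (natDegree_mul_le_of_le hC hB')).trans (by simp)
  · simp only [sub_comp, mul_comp, pB, pB', pC, pC', one_comp, pow_comp, X_comp, pow_add]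
    ring
  · simp only [add_comp, mul_comp, pB, pB', pC, pC', pow_add]
    ring
  · rw [mul_comp, hf, hg]
    ring

theorem hasLukacsForm_C {a : ℝ} (ha : 0 ≤ a) : HasLukacsForm 0 (C a) := by
  refine ⟨C √a, 0, by simp, by simp, by simp, by simp, ?_⟩
  simp [← C_pow, Real.sq_sqrt ha]

theorem hasLukacsForm_X_sub_C {r : ℝ} (hr : r ≤ 0) : HasLukacsForm 1 (X - C r) := by
  refine ⟨C √(1 - r) * X, C √(-r), by compute_degree, by compute_degree, by simp, by simp, ?_⟩
  simp only [mul_pow, ← C_pow, Real.sq_sqrt (show 0 ≤ 1 - r by linarith),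
    Real.sq_sqrt (show 0 ≤ -r by linarith)]
  simp
  ring

theorem hasLukacsForm_C_sub_X {r : ℝ} (hr : 1 ≤ r) : HasLukacsForm 1 (C r - X) := by
  refine ⟨C √(r - 1) * X, C √r, by compute_degree, by compute_degree, by simp, by simp, ?_⟩
  simp only [mul_pow, ← C_pow, Real.sq_sqrt (show 0 ≤ r - 1 by linarith),
    Real.sq_sqrt (show 0 ≤ r by linarith)]
  simp
  ring

theorem hasLukacsForm_sq (r : ℝ) : HasLukacsForm 2 ((X - C r) ^ 2) := by
  refine ⟨X ^ 2 - C r, 0, by compute_degree, by simp, by simp, by simp, by simp⟩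

/-- The quadratic is |y - z|², with values q² at y = 0 and t² at y = 1. The affine B in y = x² goes
from q to -t, so the quadratic minus B² vanishes at 0 and 1 and equals ((q + t)² - 1) y (1 - y). The
constant is nonnegative by the triangle inequality. -/
theorem hasLukacsForm_quadratic (z : ℂ) :
    HasLukacsForm 2 (X ^ 2 - C (2 * z.re) * X + C (‖z‖ ^ 2)) := by
  set q := ‖z‖ with hq
  set t := ‖1 - z‖ with ht
  have h1 : 1 ≤ q + t := by
    simpa [hq, ht] using norm_add_le z (1 - z)
  have h2 : t ^ 2 = 1 - 2 * z.re + q ^ 2 := by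
    rw [hq, ht, Complex.sq_norm, Complex.sq_norm, Complex.normSq_apply, Complex.normSq_apply]
    simp
    ring
  refine ⟨C (-(q + t)) * X ^ 2 + C q, C √((q + t) ^ 2 - 1) * X, by compute_degree,
    ?_, by simp, by simp, ?_⟩
  · rw [mul_comm, mul_assoc, ← sq]
    compute_degree
  · simp only [mul_pow, ← C_pow, Real.sq_sqrt (show 0 ≤ (q + t) ^ 2 - 1 by nlinarith)]
    have h3 : 2 * z.re = 1 + q ^ 2 - t ^ 2 := by linarith
    rw [h3]
    simp
    ring

theorem eval_nonneg_Icc_of_Ioo {a b r : ℝ} (hab : a < b) {g : ℝ[X]}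
    (h : ∀ y ∈ Set.Ioo a b, y ≠ r → 0 ≤ g.eval y) : ∀ y ∈ Set.Icc a b, 0 ≤ g.eval y := by
  have hcl : IsClosed {y | 0 ≤ g.eval y} := isClosed_le continuous_const g.continuous
  have h1 : Set.Ioo a b ⊆ closure (Set.Ioo a b ∩ {r}ᶜ) :=
    (dense_compl_singleton r).open_subset_closure_inter isOpen_Ioo
  have h2 : Set.Icc a b ⊆ closure (Set.Ioo a b ∩ {r}ᶜ) := by
    rw [← closure_Ioo hab.ne]
    exact closure_minimal h1 isClosed_closure
  exact fun y hy => closure_minimal (fun y hy => h y hy.1 hy.2) hcl (h2 hy)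

/-- A quotient of polynomials that are nonnegative on `[0, 1]` is nonnegative there. -/
theorem eval_nonneg_of_mul {f q g : ℝ[X]} {r : ℝ} (hfg : f = q * g)
    (hf : ∀ y ∈ Set.Icc (0 : ℝ) 1, 0 ≤ f.eval y)
    (hq : ∀ y ∈ Set.Ioo (0 : ℝ) 1, y ≠ r → 0 < q.eval y) :
    ∀ y ∈ Set.Icc (0 : ℝ) 1, 0 ≤ g.eval y := by
  refine eval_nonneg_Icc_of_Ioo (r := r) one_pos fun y hy hyr => ?_
  have h := hf y (Set.Ioo_subset_Icc_self hy)
  rw [hfg, eval_mul] at h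
  exact nonneg_of_mul_nonneg_right h (hq y hy hyr)

/-- A polynomial that is nonnegative on `[0, 1]` and has an interior root has it twice. -/
theorem sq_dvd_of_interior_root {f : ℝ[X]} {r : ℝ} (hr : r ∈ Set.Ioo (0 : ℝ) 1)
    (hf : ∀ y ∈ Set.Icc (0 : ℝ) 1, 0 ≤ f.eval y) (h0 : f.IsRoot r) : (X - C r) ^ 2 ∣ f := by
  obtain ⟨g, rfl⟩ := dvd_iff_isRoot.2 h0
  rw [sq]
  -- The cofactor is nonpositive to the left of r and nonnegative to the right, so it vanishes at r.
  refine mul_dvd_mul_left _ (dvd_iff_isRoot.2 (le_antisymm ?_ ?_))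
  · have := eval_nonneg_Icc_of_Ioo (g := -g) (r := r) hr.1 (fun y hy _ => by
      have h := hf y ⟨hy.1.le, (hy.2.trans hr.2).le⟩
      simp only [eval_mul, eval_sub, eval_X, eval_C, eval_neg] at h ⊢
      nlinarith [hy.2]) r ⟨hr.1.le, le_rfl⟩
    simpa using this
  · exact eval_nonneg_Icc_of_Ioo (g := g) (r := r) hr.2 (fun y hy _ => by
      have h := hf y ⟨(hr.1.trans hy.1).le, hy.2.le⟩
      simp only [eval_mul, eval_sub, eval_X, eval_C] at h
      nlinarith [hy.1]) r ⟨le_rfl, hr.2.le⟩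

/-- The Markov–Lukács theorem on `[0, 1]`, in the variable `y = x²`. -/
theorem hasLukacsForm_of_nonneg (N : ℕ) : ∀ f : ℝ[X], f ≠ 0 → f.natDegree = N →
    (∀ y ∈ Set.Icc (0 : ℝ) 1, 0 ≤ f.eval y) → HasLukacsForm N f := by
  induction N using Nat.strong_induction_on with
  | _ N ih =>
  intro f hf0 hN hf
  -- A factor positive on (0, 1) except perhaps at r leaves a nonnegative cofactor of smaller
  -- degree, to which the induction applies.
  have split : ∀ (q g : ℝ[X]) (r : ℝ) (k : ℕ), f = q * g → q.natDegree = k → 0 < k →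
      HasLukacsForm k q → (∀ y ∈ Set.Ioo (0 : ℝ) 1, y ≠ r → 0 < q.eval y) →
      HasLukacsForm N f := by
    intro q g r k hqg hk hk0 hq hpos
    have hg0 : g ≠ 0 := fun h => hf0 (by simp [hqg, h])
    have hq0 : q ≠ 0 := fun h => hf0 (by simp [hqg, h])
    have hdeg : N = k + g.natDegree := by rw [← hN, hqg, natDegree_mul hq0 hg0, hk]
    rw [hdeg, hqg]
    exact hq.mul (ih _ (by omega) g hg0 rfl (eval_nonneg_of_mul hqg hf hpos))
  rcases Nat.eq_zero_or_pos N with rfl | hNpos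
  · obtain ⟨a, rfl⟩ := natDegree_eq_zero.1 hN
    exact hasLukacsForm_C (by simpa using hf 0 (by simp))
  obtain ⟨z, hz⟩ := IsAlgClosed.exists_aeval_eq_zero ℂ f
    (by rw [degree_eq_natDegree hf0, hN]; exact_mod_cast hNpos.ne')
  by_cases him : z.im = 0
  · have hroot : f.IsRoot z.re := by
      have : z = algebraMap ℝ ℂ z.re := Complex.ext rfl (by simpa using him)
      rw [this, aeval_algebraMap_apply] at hz
      simpa using hz
    set r := z.re
    rcases le_or_gt r 0 with hr | hr
    · obtain ⟨g, hg⟩ := dvd_iff_isRoot.2 hroot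
      exact split _ g r 1 hg (natDegree_X_sub_C r) one_pos (hasLukacsForm_X_sub_C hr)
        fun y hy _ => by simp; linarith [hy.1]
    rcases le_or_gt 1 r with hr1 | hr1
    · obtain ⟨g, hg⟩ := dvd_iff_isRoot.2 hroot
      refine split (C r - X) (-g) r 1 (by rw [hg]; ring) ?_ one_pos (hasLukacsForm_C_sub_X hr1)
        fun y hy _ => by simp; linarith [hy.2]
      rw [← neg_sub, natDegree_neg, natDegree_X_sub_C]
    · obtain ⟨g, hg⟩ := sq_dvd_of_interior_root ⟨hr, hr1⟩ hf hroot
      refine split _ g r 2 hg (by simp) two_pos (hasLukacsForm_sq r) fun y _ hyr => ?_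
      have : y - r ≠ 0 := sub_ne_zero.2 hyr
      simp only [eval_pow, eval_sub, eval_X, eval_C]
      positivity
  · obtain ⟨g, hg⟩ := quadratic_dvd_of_aeval_eq_zero_im_ne_zero f hz him
    refine split _ g 0 2 hg (by compute_degree!) two_pos (hasLukacsForm_quadratic z)
      fun y _ _ => ?_
    have h1 : ‖z‖ ^ 2 = z.re ^ 2 + z.im ^ 2 := by
      rw [Complex.sq_norm, Complex.normSq_apply]; ring
    have h2 : 0 < z.im ^ 2 := by positivity
    simp only [eval_add, eval_sub, eval_mul, eval_pow, eval_X, eval_C, h1]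
    nlinarith [sq_nonneg (y - z.re)]

/-! ### The complement of a bounded real polynomial -/

theorem coeff_eq_zero_of_parity {R : Type*} [CommRing R] [NoZeroDivisors R] [CharZero R]
    {P : R[X]} {d : ℕ} (h : P.comp (-X) = (-1) ^ d * P) {k : ℕ} (hk : Odd (k + d)) :
    P.coeff k = 0 := by
  have h1 := congrArg (fun q => q.coeff k) h
  have h2 : ((-1 : R[X]) ^ d) = C ((-1) ^ d) := by simp
  have h3 : (-X : R[X]) = C (-1) * X := by simp
  simp only [h3, comp_C_mul_X_coeff, h2, coeff_C_mul] at h1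
  rcases Nat.even_or_odd d with hd | hd
  · have hk' : Odd k := by grind
    rw [hk'.neg_one_pow, hd.neg_one_pow] at h1
    exact self_eq_neg.1 (by linear_combination -h1)
  · have hk' : Even k := by grind
    rw [hk'.neg_one_pow, hd.neg_one_pow] at h1
    exact self_eq_neg.1 (by linear_combination h1)

/-- A real polynomial of definite parity bounded by `1` on `[-1, 1]` has a complement. -/
theorem exists_complement {d : ℕ} (hd : 0 < d) {P : ℝ[X]} (hdeg : P.natDegree = d)
    (hpar : P.comp (-X) = (-1) ^ d * P) (hP : ∀ x ∈ Set.Icc (-1 : ℝ) 1, |P.eval x| ≤ 1) :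
    ∃ B C : ℝ[X], B.natDegree ≤ d ∧ (X * C).natDegree ≤ d ∧
      B.comp (-X) = (-1) ^ d * B ∧ C.comp (-X) = -(-1) ^ d * C ∧
      P ^ 2 + B ^ 2 + (1 - X ^ 2) * C ^ 2 = 1 := by
  have heven : (1 - P ^ 2).comp (-X) = (-1) ^ 0 * (1 - P ^ 2) := by
    simp only [sub_comp, one_comp, pow_comp, hpar, mul_pow, ← pow_mul, mul_comm d 2]
    simp
  -- Evenness makes 1 - P² a polynomial f in x².
  have hf : expand ℝ 2 (contract 2 (1 - P ^ 2)) = 1 - P ^ 2 := by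
    ext k
    rw [coeff_expand two_pos]
    split_ifs with hk
    · rw [coeff_contract two_ne_zero, Nat.div_mul_cancel hk]
    · exact (coeff_eq_zero_of_parity heven (by simpa [← even_iff_two_dvd] using hk)).symm
  set f := contract 2 (1 - P ^ 2) with hfdef
  have h2 : (1 - P ^ 2).natDegree = 2 * d := by
    rw [natDegree_sub_eq_right_of_natDegree_lt] <;> rw [natDegree_pow, hdeg]
    simpa using hd
  have hfd : f.natDegree = d := by
    have := congrArg natDegree hf
    rw [natDegree_expand, h2] at this
    omega
  have hf0 : f ≠ 0 := by
    rintro h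
    rw [h] at hfd
    simp at hfd
    omega
  obtain ⟨B, C, hB, hC, pB, pC, h⟩ := hasLukacsForm_of_nonneg d f hf0 hfd (by
    intro y hy
    have h1 := congrArg (eval √y) hf
    rw [expand_eval, Real.sq_sqrt hy.1] at h1
    rw [h1]
    have h3 := hP √y ⟨by linarith [Real.sqrt_nonneg y], Real.sqrt_le_one.2 hy.2⟩
    have h4 := (sq_le_one_iff_abs_le_one _).2 h3
    simp
    linarith)
  refine ⟨B, C, hB, hC, pB, pC, ?_⟩
  rw [← expand_eq_comp_X_pow, hf] at h
  linear_combination -h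

/-! ### Quantum signal processing -/

open scoped ComplexConjugate

/-- The first column `(P, √(1 - x²) Q)` of the product of the reflections
`[[x, √(1 - x²)], [√(1 - x²), -x]]` interleaved with the rotations `exp(i ψ k Z)`. -/
noncomputable def qspPair (ψ : ℕ → ℝ) : ℕ → ℂ[X] × ℂ[X]
  | 0 => (C (Complex.exp (Complex.I * ψ 0)), 0)
  | k + 1 =>
    (C (Complex.exp (Complex.I * ψ (k + 1))) *
        (X * (qspPair ψ k).1 + (1 - X ^ 2) * (qspPair ψ k).2),
      C (Complex.exp (-(Complex.I * ψ (k + 1)))) *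
        ((qspPair ψ k).1 - X * (qspPair ψ k).2))

theorem qspPair_congr {ψ χ : ℕ → ℝ} {d : ℕ} (h : ∀ k ≤ d, ψ k = χ k) :
    qspPair ψ d = qspPair χ d := by
  induction d with
  | zero => simp [qspPair, h 0 le_rfl]
  | succ d ih => simp only [qspPair, ih fun k hk => h k (by omega), h (d + 1) le_rfl]

theorem conj_exp_I_mul (x : ℝ) :
    conj (Complex.exp (Complex.I * x)) = Complex.exp (-(Complex.I * x)) := by
  rw [← Complex.exp_conj]
  simp

theorem conj_exp_neg_I_mul (x : ℝ) :
    conj (Complex.exp (-(Complex.I * x))) = Complex.exp (Complex.I * x) := by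
  rw [← Complex.exp_conj]
  simp

/-- This is what makes the average over ψ and -ψ the real part at real points. -/
theorem qspPair_neg (ψ : ℕ → ℝ) (d : ℕ) :
    qspPair (-ψ) d = ((qspPair ψ d).1.map conj, (qspPair ψ d).2.map conj) := by
  induction d with
  | zero => simp [qspPair, conj_exp_I_mul]
  | succ d ih => simp [qspPair, ih, conj_exp_I_mul, conj_exp_neg_I_mul]

theorem exists_phase_of_norm_eq {p q : ℂ} (h : ‖p‖ = ‖q‖) :
    ∃ φ : ℝ, Complex.exp (-(Complex.I * φ)) * p = Complex.exp (Complex.I * φ) * q := by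
  refine ⟨(p.arg - q.arg) / 2, ?_⟩
  have hp := Complex.norm_mul_exp_arg_mul_I p
  have hq := Complex.norm_mul_exp_arg_mul_I q
  rw [h] at hp
  generalize p.arg = a at *
  generalize q.arg = b at *
  rw [← hp, ← hq, norm_mul, Complex.norm_exp_ofReal_mul_I, mul_one, Complex.norm_real, norm_norm,
    mul_left_comm, mul_left_comm _ (‖q‖ : ℂ), ← Complex.exp_add, ← Complex.exp_add]
  congr 2
  push_cast
  ring

theorem natDegree_le_of_parity {P : ℂ[X]} {d : ℕ} (hP : P.natDegree ≤ d + 2)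
    (hpar : P.comp (-X) = (-1) ^ d * P) (h : P.coeff (d + 2) = 0) : P.natDegree ≤ d := by
  rw [natDegree_le_iff_coeff_eq_zero]
  intro k hk
  rcases lt_trichotomy k (d + 2) with h1 | rfl | h1
  · obtain rfl : k = d + 1 := by omega
    exact coeff_eq_zero_of_parity hpar ⟨d, by ring⟩
  · exact h
  · exact coeff_eq_zero_of_natDegree_lt (by omega)

/-- Completeness of quantum signal processing: the pairs `(P, Q)` of the right degrees and
parities with `|P|² + (1 - x²) |Q|² = 1` are those given by phases. -/
theorem exists_phases (d : ℕ) : ∀ P Q : ℂ[X], P.natDegree ≤ d → (X * Q).natDegree ≤ d →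
    P.comp (-X) = (-1) ^ d * P → Q.comp (-X) = -(-1) ^ d * Q →
    P * P.map conj + (1 - X ^ 2) * (Q * Q.map conj) = 1 →
    ∃ ψ : ℕ → ℝ, qspPair ψ d = (P, Q) := by
  induction d with
  | zero =>
    intro P Q hP hQ _ _ hn
    have hQ0 : Q = 0 := by
      by_contra h
      rw [natDegree_X_mul h] at hQ
      omega
    obtain ⟨a, rfl⟩ := natDegree_eq_zero.1 (Nat.le_zero.1 hP)
    subst hQ0
    simp only [map_C, zero_mul, mul_zero, add_zero, ← C_mul, ← C_1] at hn
    have hn1 : ‖a‖ = 1 := by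
      have h1 := C_injective hn
      rw [Complex.mul_conj, Complex.normSq_eq_norm_sq] at h1
      have h2 : ‖a‖ ^ 2 = 1 := by exact_mod_cast h1
      exact (pow_eq_one_iff_of_nonneg (norm_nonneg a) two_ne_zero).1 h2
    refine ⟨fun _ => a.arg, ?_⟩
    have := Complex.norm_mul_exp_arg_mul_I a
    rw [hn1, Complex.ofReal_one, one_mul, mul_comm] at this
    simp [qspPair, this]
  | succ d ih =>
    intro P Q hP hQ pP pQ hn
    have hQ' : Q.natDegree ≤ d := by
      by_cases h : Q = 0
      · simp [h]
      · rw [natDegree_X_mul h] at hQ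
        omega
    have hcP : (P * P.map conj).coeff ((d + 1) + (d + 1)) =
        P.coeff (d + 1) * conj (P.coeff (d + 1)) := by
      rw [coeff_mul_add_eq_of_natDegree_le hP (natDegree_map_le.trans hP), coeff_map]
    have hcQ : (X * Q * (X * Q).map conj).coeff ((d + 1) + (d + 1)) =
        Q.coeff d * conj (Q.coeff d) := by
      rw [coeff_mul_add_eq_of_natDegree_le hQ (natDegree_map_le.trans hQ), coeff_map,
        coeff_X_mul]
    have hcQ0 : (Q * Q.map conj).coeff ((d + 1) + (d + 1)) = 0 := by
      refine coeff_eq_zero_of_natDegree_lt ?_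
      have := natDegree_mul_le_of_le hQ' (natDegree_map_le (f := conj) |>.trans hQ')
      omega
    -- The coefficient of degree 2(d + 1) in the normalization is |P_{d+1}|² - |Q_d|², and it must
    -- vanish.
    have hlead : ‖P.coeff (d + 1)‖ = ‖Q.coeff d‖ := by
      have h1 : P * P.map conj + Q * Q.map conj - X * Q * (X * Q).map conj = 1 := by
        rw [Polynomial.map_mul, map_X, ← hn]
        ring
      have h2 := congrArg (fun p => p.coeff ((d + 1) + (d + 1))) h1
      simp only [coeff_sub, coeff_add, hcP, hcQ, hcQ0, Complex.mul_conj, Complex.normSq_eq_norm_sq,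
        coeff_one] at h2
      rw [if_neg (by omega), add_zero, sub_eq_zero] at h2
      have h3 : ‖P.coeff (d + 1)‖ ^ 2 = ‖Q.coeff d‖ ^ 2 := by exact_mod_cast h2
      exact (pow_left_inj₀ (norm_nonneg _) (norm_nonneg _) two_ne_zero).1 h3
    obtain ⟨φ, hφ⟩ := exists_phase_of_norm_eq hlead
    set e := Complex.exp (Complex.I * φ) with he
    set e' := Complex.exp (-(Complex.I * φ)) with he'
    have hee : e * e' = 1 := by rw [he, he', ← Complex.exp_add]; simp
    have hCe : C e * C e' = (1 : ℂ[X]) := by rw [← C_mul, hee, C_1]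
    have hce : conj e = e' := conj_exp_I_mul φ
    have hce' : conj e' = e := conj_exp_neg_I_mul φ
    -- Undo the last phase, then the reflection, which is its own inverse.
    set P₀ := X * (C e' * P) + (1 - X ^ 2) * (C e * Q) with hP₀
    set Q₀ := C e' * P - X * (C e * Q) with hQ₀
    have par₁ : P₀.comp (-X) = (-1) ^ d * P₀ := by
      simp only [hP₀, add_comp, mul_comp, sub_comp, one_comp, pow_comp, X_comp, C_comp, pP, pQ,
        pow_succ]
      ring
    have par₂ : Q₀.comp (-X) = -(-1) ^ d * Q₀ := by
      simp only [hQ₀, mul_comp, sub_comp, X_comp, C_comp, pP, pQ, pow_succ]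
      ring
    -- The choice of φ cancels the coefficient of degree d + 2, and parity excludes degree d + 1.
    have dQ : (X * Q₀).natDegree ≤ d := by
      refine natDegree_le_of_parity ?_ ?_ ?_
      · refine (natDegree_mul_le_of_le natDegree_X_le (m := 1) (n := d + 1) ?_).trans (by omega)
        refine (natDegree_sub_le_of_le ((natDegree_C_mul_le _ _).trans hP) (n := d + 1) ?_).trans
          (by simp)
        rw [mul_left_comm]
        exact (natDegree_C_mul_le _ _).trans hQ
      · rw [mul_comp, X_comp, par₂]
        ring
      · rw [coeff_X_mul, hQ₀, coeff_sub, coeff_C_mul, coeff_X_mul, coeff_C_mul, hφ, sub_self]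
    have dP : P₀.natDegree ≤ d := by
      have h1 : P₀ = C e * Q + X * Q₀ := by rw [hP₀, hQ₀]; ring
      rw [h1]
      exact (natDegree_add_le_of_le ((natDegree_C_mul_le _ _).trans hQ') dQ).trans (by simp)
    have hn₀ : P₀ * P₀.map conj + (1 - X ^ 2) * (Q₀ * Q₀.map conj) = 1 := by
      simp only [hP₀, hQ₀, Polynomial.map_add, Polynomial.map_sub, Polynomial.map_mul, map_X,
        map_C, Polynomial.map_one, Polynomial.map_pow, hce, hce']
      linear_combination hn + (P * P.map conj + (1 - X ^ 2) * (Q * Q.map conj)) * hCe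
    obtain ⟨ψ, hψ⟩ := ih P₀ Q₀ dP dQ par₁ par₂ hn₀
    refine ⟨Function.update ψ (d + 1) φ, ?_⟩
    have h1 : qspPair (Function.update ψ (d + 1) φ) d = (P₀, Q₀) := by
      rw [← hψ]
      exact qspPair_congr fun k hk => Function.update_of_ne (by omega) _ _
    simp only [qspPair, h1, Function.update_self, ← he, ← he']
    refine Prod.ext ?_ ?_
    · simp only [hP₀, hQ₀]
      linear_combination P * hCe
    · simp only [hP₀, hQ₀]
      linear_combination Q * hCe

/-- Every admissible real polynomial is the real part of one given by phases. -/
theorem exists_phases_real {d : ℕ} (hd : 0 < d) {P : ℝ[X]} (hdeg : P.natDegree = d)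
    (hpar : P.comp (-X) = (-1) ^ d * P) (hP : ∀ x ∈ Set.Icc (-1 : ℝ) 1, |P.eval x| ≤ 1) :
    ∃ ψ : ℕ → ℝ, ∀ x : ℝ, (qspPair ψ d).1.eval (x : ℂ) + (qspPair (-ψ) d).1.eval (x : ℂ) =
      2 * ((P.eval x : ℝ) : ℂ) := by
  obtain ⟨B, Q, hB, hQ, pB, pQ, hn⟩ := exists_complement hd hdeg hpar hP
  have hconj : ∀ R : ℝ[X], (R.map Complex.ofRealHom).map conj = R.map Complex.ofRealHom := by
    intro R
    ext k
    simp
  have hmap := congrArg (Polynomial.map Complex.ofRealHom) hn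
  have hmapP := congrArg (Polynomial.map Complex.ofRealHom) hpar
  have hmapB := congrArg (Polynomial.map Complex.ofRealHom) pB
  have hmapQ := congrArg (Polynomial.map Complex.ofRealHom) pQ
  simp only [Polynomial.map_add, Polynomial.map_sub, Polynomial.map_mul, Polynomial.map_pow,
    Polynomial.map_one, map_X, Polynomial.map_neg, map_comp] at hmap hmapP hmapB hmapQ
  have hI : C Complex.I * C Complex.I = (-1 : ℂ[X]) := by
    rw [← C_mul, Complex.I_mul_I, C_neg, C_1]
  -- For real P and B, |P + iB|² = P² + B², so the complement supplies the normalization.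
  obtain ⟨ψ, hψ⟩ := exists_phases d
    (P.map Complex.ofRealHom + C Complex.I * B.map Complex.ofRealHom) (Q.map Complex.ofRealHom)
    ((natDegree_add_le_of_le (natDegree_map_le.trans hdeg.le)
      ((natDegree_C_mul_le _ _).trans (natDegree_map_le.trans hB))).trans (by simp))
    (by
      have : X * Q.map Complex.ofRealHom = (X * Q).map Complex.ofRealHom := by simp
      rw [this]
      exact natDegree_map_le.trans hQ)
    (by rw [add_comp, mul_comp, C_comp, hmapP, hmapB]; ring)
    hmapQ
    (by
      simp only [Polynomial.map_add, Polynomial.map_mul, hconj, map_C, Complex.conj_I, C_neg]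
      linear_combination hmap - (B.map Complex.ofRealHom) ^ 2 * hI)
  refine ⟨ψ, fun x => ?_⟩
  rw [qspPair_neg, hψ]
  have hx : ∀ R : ℝ[X], (R.map Complex.ofRealHom).eval (x : ℂ) = ((R.eval x : ℝ) : ℂ) :=
    fun R => eval_map_apply Complex.ofRealHom x
  simp only [Polynomial.map_add, Polynomial.map_mul, hconj, map_C, Complex.conj_I, C_neg,
    eval_add, eval_mul, eval_neg, eval_C, hx]
  ring

/-! ### Alternating products on the invariant subspaces -/

open Matrix

section Alternating

variable {κ ι : Type*} [Fintype κ] [DecidableEq κ] [Fintype ι] [DecidableEq ι]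

/-- The phase gate `exp(i φ (2 R - 1))` of a projector `R`. -/
noncomputable def phaseGate (R : Matrix κ κ ℂ) (φ : ℝ) : Matrix κ κ ℂ :=
  Complex.exp (Complex.I * φ) • R + Complex.exp (-(Complex.I * φ)) • (1 - R)

/-- Phase gates interleaved with alternating uses of `U` and `U†`, the rightmost being `U`. -/
noncomputable def alternating (R U : Matrix κ κ ℂ) (ψ : ℕ → ℝ) : ℕ → Matrix κ κ ℂ
  | 0 => phaseGate R (ψ 0)
  | k + 1 => phaseGate R (ψ (k + 1)) * ((if Even k then U else Uᴴ) * alternating R U ψ k)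

theorem phaseGate_mul_of_range {E : Matrix κ ι ℂ} (hE : Eᴴ * E = 1) (φ : ℝ) :
    phaseGate (E * Eᴴ) φ * E = Complex.exp (Complex.I * φ) • E := by
  rw [phaseGate, Matrix.add_mul, Matrix.smul_mul, Matrix.smul_mul, Matrix.sub_mul,
    Matrix.mul_assoc, hE]
  simp

theorem phaseGate_mul_of_compl {E : Matrix κ ι ℂ} (hE : Eᴴ * E = 1) (φ : ℝ) :
    phaseGate (E * Eᴴ) φ * (1 - E * Eᴴ) = Complex.exp (-(Complex.I * φ)) • (1 - E * Eᴴ) := by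
  have h : E * Eᴴ * (E * Eᴴ) = E * Eᴴ := by
    rw [Matrix.mul_assoc, ← Matrix.mul_assoc Eᴴ, hE, Matrix.one_mul]
  rw [phaseGate, Matrix.add_mul, Matrix.smul_mul, Matrix.smul_mul, Matrix.sub_mul,
    Matrix.mul_sub, Matrix.one_mul, Matrix.mul_one, h]
  simp

/-- One use of `U` acts on the invariant subspaces as the reflection
`[[x, √(1 - x²)], [√(1 - x²), -x]]`. -/
theorem encoding_mul_pair {U : Matrix κ κ ℂ} {E : Matrix κ ι ℂ} {V W : Matrix ι ι ℂ}
    {σ p q : ι → ℂ} (hU : U * Uᴴ = 1)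
    (hV : (Eᴴ * U * E) * V = W * diagonal σ) (hW : (Eᴴ * Uᴴ * E) * W = V * diagonal σ) :
    U * (E * V * diagonal p + (1 - E * Eᴴ) * (Uᴴ * E * W) * diagonal q) =
      E * W * diagonal (fun i => σ i * p i + (1 - σ i ^ 2) * q i) +
        (1 - E * Eᴴ) * (U * E * V) * diagonal (fun i => p i - σ i * q i) := by
  have h1 : U * E * V = E * W * diagonal σ + (1 - E * Eᴴ) * (U * E * V) := by
    rw [Matrix.mul_assoc E W, ← hV, Matrix.sub_mul]
    simp only [Matrix.mul_assoc, Matrix.one_mul]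
    abel
  set S := (1 - E * Eᴴ) * (U * E * V) with hS
  have h2 : U * ((1 - E * Eᴴ) * (Uᴴ * E * W)) = E * W - U * E * V * diagonal σ := by
    rw [Matrix.mul_assoc (U * E), ← hW, Matrix.sub_mul, Matrix.mul_sub, Matrix.one_mul]
    congr 1
    · rw [← Matrix.mul_assoc, ← Matrix.mul_assoc, hU, Matrix.one_mul]
    · simp only [Matrix.mul_assoc]
  have h3 : diagonal (fun i => σ i * p i + (1 - σ i ^ 2) * q i) =
      diagonal σ * diagonal p + diagonal q - diagonal σ * (diagonal σ * diagonal q) := by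
    simp only [diagonal_mul_diagonal, diagonal_add, diagonal_sub]
    congr 1
    ext i
    ring
  have h4 : diagonal (fun i => p i - σ i * q i) = diagonal p - diagonal σ * diagonal q := by
    simp only [diagonal_mul_diagonal, diagonal_sub]
  rw [Matrix.mul_add, ← Matrix.mul_assoc U, ← Matrix.mul_assoc U, ← Matrix.mul_assoc U, h2, h1,
    h3, h4]
  simp only [Matrix.mul_add, Matrix.add_mul, Matrix.mul_sub, Matrix.sub_mul, Matrix.mul_assoc]
  abel

/-- The columns of (1 - E E†) U† E W and (1 - E E†) U E V have squared norm 1 - σ². Leaving them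
unnormalized absorbs the factor √(1 - x²) omitted from the second entry of `qspPair`, so nothing is
divided by √(1 - σ²) and σ = 1 is not special. -/
theorem alternating_mul {U : Matrix κ κ ℂ} {E : Matrix κ ι ℂ} (hU : U ∈ unitaryGroup κ ℂ)
    (hE : Eᴴ * E = 1) {A : Matrix ι ι ℂ} (hA : A = Eᴴ * U * E) (D : SVD A) (ψ : ℕ → ℝ) (k : ℕ) :
    alternating (E * Eᴴ) U ψ k * E =
      (E * (if Even k then D.V else D.W) *
          diagonal (fun i => (qspPair ψ k).1.eval (D.σ i : ℂ)) +
        (1 - E * Eᴴ) * (if Even k then Uᴴ * E * D.W else U * E * D.V) *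
          diagonal (fun i => (qspPair ψ k).2.eval (D.σ i : ℂ))) * D.Vᴴ := by
  have hVV : D.Vᴴ * D.V = 1 := mem_unitaryGroup_iff'.1 D.V_unitary
  have hVV' : D.V * D.Vᴴ = 1 := mem_unitaryGroup_iff.1 D.V_unitary
  have hWW : D.Wᴴ * D.W = 1 := mem_unitaryGroup_iff'.1 D.W_unitary
  have hV : (Eᴴ * U * E) * D.V = D.W * diagonal (fun i => (D.σ i : ℂ)) := by
    rw [← hA, show A * D.V = _ from congrArg (· * D.V) D.eq_mul]
    simp only [Matrix.mul_assoc, hVV, Matrix.mul_one]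
  have hW : (Eᴴ * Uᴴ * E) * D.W = D.V * diagonal (fun i => (D.σ i : ℂ)) := by
    have h1 : Eᴴ * Uᴴ * E = Aᴴ := by
      rw [hA]
      simp only [conjTranspose_mul, conjTranspose_conjTranspose, Matrix.mul_assoc]
    have h2 : Aᴴ = D.V * (diagonal (fun i => (D.σ i : ℂ)) * D.Wᴴ) := by
      rw [show Aᴴ = _ from congrArg conjTranspose D.eq_mul]
      simp only [conjTranspose_mul, conjTranspose_conjTranspose, diagonal_conjTranspose]
      congr 3
      ext i
      simp
    rw [h1, h2, Matrix.mul_assoc, Matrix.mul_assoc, hWW, Matrix.mul_one]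
  induction k with
  | zero =>
    rw [alternating, phaseGate_mul_of_range hE]
    simp only [qspPair, Even.zero, if_true, eval_C, eval_zero, diagonal_zero, Matrix.mul_zero,
      add_zero]
    rw [show (diagonal fun _ : ι => Complex.exp (Complex.I * (ψ 0 : ℂ))) =
      Complex.exp (Complex.I * (ψ 0 : ℂ)) • (1 : Matrix ι ι ℂ) by
        rw [smul_one_eq_diagonal], Matrix.mul_smul, Matrix.mul_one, Matrix.smul_mul,
      Matrix.mul_assoc, hVV', Matrix.mul_one]
  | succ k ih =>
    rw [alternating, Matrix.mul_assoc, Matrix.mul_assoc, ih, ← Matrix.mul_assoc _ _ D.Vᴴ,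
      ← Matrix.mul_assoc _ _ D.Vᴴ]
    congr 1
    -- The phase gate multiplies the two components by conjugate phases, as in the recursion of
    -- `qspPair`; this serves both parities.
    have step : ∀ (Y : Matrix ι ι ℂ) (Z : Matrix κ ι ℂ) (p q : ℂ[X]) (φ : ℝ),
        phaseGate (E * Eᴴ) φ * (E * Y * diagonal
            (fun i => (D.σ i : ℂ) * p.eval (D.σ i : ℂ) +
              (1 - (D.σ i : ℂ) ^ 2) * q.eval (D.σ i : ℂ)) +
          (1 - E * Eᴴ) * Z * diagonal
            (fun i => p.eval (D.σ i : ℂ) - (D.σ i : ℂ) * q.eval (D.σ i : ℂ))) =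
        E * Y * diagonal (fun i => (C (Complex.exp (Complex.I * φ)) *
            (X * p + (1 - X ^ 2) * q)).eval (D.σ i : ℂ)) +
          (1 - E * Eᴴ) * Z * diagonal (fun i => (C (Complex.exp (-(Complex.I * φ))) *
            (p - X * q)).eval (D.σ i : ℂ)) := by
      intro Y Z p q φ
      have hs : ∀ (c : ℂ) (f : ι → ℂ), diagonal (fun i => c * f i) = c • diagonal f :=
        fun c f => by rw [← diagonal_smul]; rfl
      simp only [eval_mul, eval_add, eval_sub, eval_C, eval_X, eval_one, eval_pow, hs]
      rw [Matrix.mul_add, ← Matrix.mul_assoc, ← Matrix.mul_assoc, ← Matrix.mul_assoc,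
        ← Matrix.mul_assoc, phaseGate_mul_of_range hE, phaseGate_mul_of_compl hE]
      simp only [Matrix.mul_smul, Matrix.smul_mul]
    rcases Nat.even_or_odd k with hk | hk
    · have hk1 : ¬ Even (k + 1) := by grind
      simp only [if_pos hk, if_neg hk1]
      rw [encoding_mul_pair (mem_unitaryGroup_iff.1 hU) hV hW, step]
      rfl
    · have hk0 : ¬ Even k := by grind
      have hk1 : Even (k + 1) := by grind
      simp only [if_pos hk1, if_neg hk0]
      -- A use of U† is the same reflection with V and W exchanged.
      have := encoding_mul_pair (U := Uᴴ) (E := E) (V := D.W) (W := D.V)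
        (σ := fun i => (D.σ i : ℂ)) (p := fun i => (qspPair ψ k).1.eval (D.σ i : ℂ))
        (q := fun i => (qspPair ψ k).2.eval (D.σ i : ℂ))
        (by rw [conjTranspose_conjTranspose]; exact mem_unitaryGroup_iff'.1 hU) hW
        (by rw [conjTranspose_conjTranspose]; exact hV)
      rw [conjTranspose_conjTranspose] at this
      rw [this, step]
      rfl

/-- Quantum singular value transformation: the block of the alternating product. -/
theorem block_alternating {U : Matrix κ κ ℂ} {E : Matrix κ ι ℂ} (hU : U ∈ unitaryGroup κ ℂ)
    (hE : Eᴴ * E = 1) {A : Matrix ι ι ℂ} (hA : A = Eᴴ * U * E) (D : SVD A) (ψ : ℕ → ℝ) (k : ℕ) :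
    Eᴴ * alternating (E * Eᴴ) U ψ k * E = (if Even k then D.V else D.W) *
      diagonal (fun i => (qspPair ψ k).1.eval (D.σ i : ℂ)) * D.Vᴴ := by
  have h0 : Eᴴ * (1 - E * Eᴴ) = 0 := by
    rw [Matrix.mul_sub, ← Matrix.mul_assoc, hE]
    simp
  rw [Matrix.mul_assoc, alternating_mul hU hE hA D, ← Matrix.mul_assoc, Matrix.mul_add]
  simp only [← Matrix.mul_assoc]
  simp only [hE, h0, Matrix.one_mul, Matrix.zero_mul, add_zero]

end Alternating

/-! ### The ancilla isometry and unitarity of the gates -/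

/-- The isometry `|0^m⟩ ⊗ I`. -/
def zeroIsometry (m n : ℕ) : Matrix (Bits m × Bits n) (Bits n) ℂ :=
  of fun a j => if a = (0, j) then 1 else 0

theorem mul_zeroIsometry {m n : ℕ} {κ : Type*} (M : Matrix κ (Bits m × Bits n) ℂ) (i : κ)
    (j : Bits n) : (M * zeroIsometry m n) i j = M i (0, j) := by
  simp [zeroIsometry, Matrix.mul_apply]

theorem conjTranspose_zeroIsometry_mul {m n : ℕ} {κ : Type*}
    (M : Matrix (Bits m × Bits n) κ ℂ) (i : Bits n) (j : κ) :
    ((zeroIsometry m n)ᴴ * M) i j = M (0, i) j := by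
  simp [zeroIsometry, Matrix.mul_apply, conjTranspose_apply, apply_ite]

theorem zeroIsometry_isometry (m n : ℕ) : (zeroIsometry m n)ᴴ * zeroIsometry m n = 1 := by
  ext i j
  rw [conjTranspose_zeroIsometry_mul]
  simp [zeroIsometry, Matrix.one_apply]

theorem zeroIsometry_mul_conjTranspose (m n : ℕ) :
    zeroIsometry m n * (zeroIsometry m n)ᴴ = zeroProjector m n := by
  ext ⟨a, i⟩ ⟨b, j⟩
  simp only [zeroIsometry, Matrix.mul_apply, conjTranspose_apply, of_apply, zeroProjector,
    kroneckerMap_apply, single_apply, Matrix.one_apply, Prod.mk.injEq]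
  rw [Finset.sum_eq_single i (by intro k _ hk; simp [hk.symm]) (by simp)]
  by_cases ha : a = 0 <;> by_cases hb : b = 0 <;> by_cases hij : i = j <;>
    simp [ha, hb, hij, eq_comm]

theorem block_eq {m n : ℕ} (M : Matrix (Bits m × Bits n) (Bits m × Bits n) ℂ) :
    of (fun i j : Bits n => M (0, i) (0, j)) = (zeroIsometry m n)ᴴ * M * zeroIsometry m n := by
  ext i j
  rw [mul_zeroIsometry, conjTranspose_zeroIsometry_mul]
  rfl

theorem zeroProjector_mul_self (m n : ℕ) :
    zeroProjector m n * zeroProjector m n = zeroProjector m n := by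
  rw [zeroProjector, ← mul_kronecker_mul]
  simp

theorem zeroProjector_conjTranspose (m n : ℕ) : (zeroProjector m n)ᴴ = zeroProjector m n := by
  rw [← zeroIsometry_mul_conjTranspose, conjTranspose_mul, conjTranspose_conjTranspose]

theorem one_div_sqrt_two_mul_self :
    ((1 / √2 : ℝ) : ℂ) * ((1 / √2 : ℝ) : ℂ) = 1 / 2 := by
  rw [← Complex.ofReal_mul, div_mul_div_comm, Real.mul_self_sqrt (by norm_num)]
  norm_num

theorem hadamardMatrix_mul_self : hadamardMatrix * hadamardMatrix = 1 := by
  rw [hadamardMatrix, Matrix.smul_mul, Matrix.mul_smul, smul_smul,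
    one_div_sqrt_two_mul_self]
  ext i j
  fin_cases i <;> fin_cases j <;> norm_num [Matrix.mul_apply, Fin.sum_univ_two]

theorem hadamardMatrix_conjTranspose : hadamardMatrixᴴ = hadamardMatrix := by
  ext i j
  fin_cases i <;> fin_cases j <;> simp [hadamardMatrix]

theorem pauliX_mul_self : pauliX * pauliX = 1 := by
  ext i j
  fin_cases i <;> fin_cases j <;> simp [pauliX]

theorem pauliX_conjTranspose : pauliXᴴ = pauliX := by
  ext i j
  fin_cases i <;> fin_cases j <;> simp [pauliX]

theorem rotationMatrix_unitary (φ : ℝ) : rotationMatrix φ * (rotationMatrix φ)ᴴ = 1 := by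
  ext i j
  fin_cases i <;> fin_cases j <;>
    simp [rotationMatrix, Matrix.mul_apply, Fin.sum_univ_two, ← Complex.exp_conj,
      ← Complex.exp_add]

theorem kronecker_mem_unitaryGroup {κ : Type*} [Fintype κ] [DecidableEq κ]
    {M : Matrix (Fin 2) (Fin 2) ℂ} {N : Matrix κ κ ℂ} (hM : M * Mᴴ = 1) (hN : N * Nᴴ = 1) :
    M ⊗ₖ N ∈ unitaryGroup (Fin 2 × κ) ℂ := by
  rw [mem_unitaryGroup_iff, star_eq_conjTranspose, conjTranspose_kronecker, ← mul_kronecker_mul,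
    hM, hN, one_kronecker_one]

theorem Gate.toMatrix_mem {m n : ℕ} {U : Matrix (Bits m × Bits n) (Bits m × Bits n) ℂ}
    (hU : U ∈ unitaryGroup (Bits m × Bits n) ℂ) (g : Gate) :
    g.toMatrix U ∈ unitaryGroup (Fin 2 × (Bits m × Bits n)) ℂ := by
  cases g with
  | hadamard =>
    exact kronecker_mem_unitaryGroup
      (by rw [hadamardMatrix_conjTranspose, hadamardMatrix_mul_self]) (by simp)
  | rotation φ => exact kronecker_mem_unitaryGroup (rotationMatrix_unitary φ) (by simp)
  | controlledNot =>
    have h := zeroProjector_mul_self m n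
    rw [mem_unitaryGroup_iff, star_eq_conjTranspose, Gate.toMatrix]
    simp only [conjTranspose_add, conjTranspose_kronecker, pauliX_conjTranspose,
      zeroProjector_conjTranspose, conjTranspose_sub, conjTranspose_one, Matrix.mul_add,
      Matrix.add_mul, ← mul_kronecker_mul, pauliX_mul_self, Matrix.mul_sub, Matrix.sub_mul, h,
      Matrix.one_mul, Matrix.mul_one, sub_self, kronecker_zero, add_zero, zero_add, sub_zero]
    rw [← kronecker_add, add_sub_cancel, one_kronecker_one]
  | encoding => exact kronecker_mem_unitaryGroup (by simp) (mem_unitaryGroup_iff.1 hU)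
  | encodingDagger =>
    exact kronecker_mem_unitaryGroup (by simp)
      (by rw [conjTranspose_conjTranspose]; exact mem_unitaryGroup_iff'.1 hU)

/-! ### The circuit and its block -/

namespace Circuit

variable {m n : ℕ} {U : Matrix (Bits m × Bits n) (Bits m × Bits n) ℂ}

theorem toMatrix_mem (hU : U ∈ unitaryGroup (Bits m × Bits n) ℂ) (c : Circuit) :
    toMatrix U c ∈ unitaryGroup (Fin 2 × (Bits m × Bits n)) ℂ := by
  induction c with
  | nil => exact one_mem _
  | cons g c ih => exact mul_mem ih (g.toMatrix_mem hU)

theorem unitary_mem (hU : U ∈ unitaryGroup (Bits m × Bits n) ℂ) (c : Circuit) :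
    c.unitary U ∈ unitaryGroup (Bits (m + 1) × Bits n) ℂ := by
  have h := mem_unitaryGroup_iff.1 (toMatrix_mem hU c)
  rw [mem_unitaryGroup_iff, star_eq_conjTranspose, unitary, conjTranspose_reindex,
    reindex_apply, reindex_apply, submatrix_mul_equiv, ← star_eq_conjTranspose, h,
    submatrix_one_equiv]

theorem toMatrix_append (c c' : Circuit) : toMatrix U (c ++ c') = toMatrix U c' * toMatrix U c := by
  induction c with
  | nil => simp [toMatrix]
  | cons g c ih => simp only [List.cons_append, toMatrix, ih, Matrix.mul_assoc]

/-- The operator that acts as `M` or `N` according to the state of the signal qubit. -/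
def signalDiagonal {κ : Type*} (M N : Matrix κ κ ℂ) : Matrix (Fin 2 × κ) (Fin 2 × κ) ℂ :=
  !![1, 0; 0, 0] ⊗ₖ M + !![0, 0; 0, 1] ⊗ₖ N

theorem signalDiagonal_mul {κ : Type*} [Fintype κ] (M N M' N' : Matrix κ κ ℂ) :
    signalDiagonal M N * signalDiagonal M' N' = signalDiagonal (M * M') (N * N') := by
  simp only [signalDiagonal, Matrix.mul_add, Matrix.add_mul, ← mul_kronecker_mul]
  have h₁ : (!![1, 0; 0, 0] : Matrix (Fin 2) (Fin 2) ℂ) * !![1, 0; 0, 0] = !![1, 0; 0, 0] := by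
    ext i j
    fin_cases i <;> fin_cases j <;> simp
  have h₂ : (!![0, 0; 0, 1] : Matrix (Fin 2) (Fin 2) ℂ) * !![0, 0; 0, 1] = !![0, 0; 0, 1] := by
    ext i j
    fin_cases i <;> fin_cases j <;> simp
  have h₃ : (!![1, 0; 0, 0] : Matrix (Fin 2) (Fin 2) ℂ) * !![0, 0; 0, 1] = 0 := by
    ext i j
    fin_cases i <;> fin_cases j <;> simp
  have h₄ : (!![0, 0; 0, 1] : Matrix (Fin 2) (Fin 2) ℂ) * !![1, 0; 0, 0] = 0 := by
    ext i j
    fin_cases i <;> fin_cases j <;> simp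
  rw [h₁, h₂, h₃, h₄, zero_kronecker, zero_kronecker, add_zero, zero_add]

theorem one_kronecker_eq {κ : Type*} (M : Matrix κ κ ℂ) :
    (1 : Matrix (Fin 2) (Fin 2) ℂ) ⊗ₖ M = signalDiagonal M M := by
  rw [signalDiagonal, ← add_kronecker]
  congr 1
  ext i j
  fin_cases i <;> fin_cases j <;> simp

/-- Conjugation by the controlled NOT flips the sign of φ exactly on the ancilla state 0^m, so
signal 0 sees exp(iφ(2R - 1)) and signal 1 its inverse. -/
theorem toMatrix_controlledRotation (φ : ℝ) : toMatrix U (controlledRotation φ) =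
    signalDiagonal (phaseGate (zeroProjector m n) φ) (phaseGate (zeroProjector m n) (-φ)) := by
  have h := zeroProjector_mul_self m n
  simp only [controlledRotation, toMatrix, Gate.toMatrix, Matrix.one_mul]
  simp only [Matrix.mul_add, Matrix.add_mul, ← mul_kronecker_mul, Matrix.mul_sub, Matrix.sub_mul,
    h, Matrix.one_mul, Matrix.mul_one, sub_self, kronecker_zero, add_zero, zero_add, sub_zero]
  ext ⟨s, a⟩ ⟨t, b⟩
  fin_cases s <;> fin_cases t <;>
    simp [signalDiagonal, phaseGate, pauliX, rotationMatrix]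

/-- The circuit between the two Hadamard gates, with the phases in the order of time. -/
def core (ψ : ℕ → ℝ) (d : ℕ) : Circuit :=
  controlledRotation (ψ 0) ++ (List.range d).flatMap (fun j =>
    (if Even j then Gate.encoding else Gate.encodingDagger) :: controlledRotation (ψ (j + 1)))

theorem toMatrix_core (ψ : ℕ → ℝ) (d : ℕ) : toMatrix U (core ψ d) =
    signalDiagonal (alternating (zeroProjector m n) U ψ d)
      (alternating (zeroProjector m n) U (-ψ) d) := by
  induction d with
  | zero => simp [core, toMatrix_controlledRotation, alternating]
  | succ d ih =>
    have hcore : core ψ (d + 1) = core ψ d ++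
        ([if Even d then Gate.encoding else Gate.encodingDagger] ++
          controlledRotation (ψ (d + 1))) := by
      simp [core, List.range_succ]
    have hgate : toMatrix U [if Even d then Gate.encoding else Gate.encodingDagger] =
        signalDiagonal (if Even d then U else Uᴴ) (if Even d then U else Uᴴ) := by
      rw [← one_kronecker_eq]
      split_ifs <;> simp [toMatrix, Gate.toMatrix]
    rw [hcore, toMatrix_append, toMatrix_append, ih, hgate, toMatrix_controlledRotation,
      signalDiagonal_mul, signalDiagonal_mul]
    simp only [alternating, Matrix.mul_assoc, Pi.neg_apply]

/-- The circuit applies φ_d first whereas ψ is indexed in the order of time, hence the reversal d -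
j. -/
theorem qsvt_eq (ψ : ℕ → ℝ) (d : ℕ) :
    qsvt (fun j : Fin (d + 1) => ψ (d - j)) = [.hadamard] ++ core ψ d ++ [.hadamard] := by
  have h : (List.range d) = (List.finRange d).map Fin.val := by simp
  rw [qsvt, core, h, List.flatMap_map]
  simp only [List.append_assoc, Fin.val_last, Nat.sub_self, Fin.val_castSucc, Fin.val_rev]
  congr 4
  funext j
  have : d - (d - (j + 1)) = (j : ℕ) + 1 := by omega
  rw [this]

/-- Both Hadamard gates turn |0⟩ into the uniform superposition, in which the two branches have
weight 1/2. -/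
theorem hadamard_sandwich {κ : Type*} [Fintype κ] [DecidableEq κ] (M N : Matrix κ κ ℂ)
    (a b : κ) :
    ((hadamardMatrix ⊗ₖ (1 : Matrix κ κ ℂ)) * signalDiagonal M N *
      (hadamardMatrix ⊗ₖ (1 : Matrix κ κ ℂ))) (0, a) (0, b) = (M a b + N a b) / 2 := by
  simp only [signalDiagonal, Matrix.mul_add, Matrix.add_mul, ← mul_kronecker_mul,
    Matrix.one_mul, Matrix.mul_one, hadamardMatrix, Matrix.smul_mul, Matrix.mul_smul, smul_smul,
    one_div_sqrt_two_mul_self]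
  simp
  ring

theorem block_qsvt (ψ : ℕ → ℝ) (d : ℕ) (i j : Bits n) :
    (qsvt (fun j : Fin (d + 1) => ψ (d - j))).unitary U (0, i) (0, j) =
      (alternating (zeroProjector m n) U ψ d (0, i) (0, j) +
        alternating (zeroProjector m n) U (-ψ) d (0, i) (0, j)) / 2 := by
  have h0 : ∀ i : Bits n, (signalEquiv m n).symm (0, i) = (0, (0, i)) := fun i => by
    rw [Equiv.symm_apply_eq]
    refine Prod.ext ?_ rfl
    funext k
    refine Fin.cases rfl (fun _ => rfl) k
  rw [unitary, reindex_apply, submatrix_apply, h0, h0, qsvt_eq, toMatrix_append, toMatrix_append,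
    toMatrix_core]
  simp only [toMatrix, Gate.toMatrix, Matrix.one_mul]
  rw [← Matrix.mul_assoc, hadamard_sandwich]

theorem gateCount_qsvt {d : ℕ} (Φ : Fin (d + 1) → ℝ) : (qsvt Φ).gateCount = 4 * d + 5 := by
  simp [qsvt, gateCount, controlledRotation, List.length_flatMap]
  ring

/-- The block of the circuit is the transformation by the real part of the polynomial. -/
theorem qsvt_isBlockEncoding {A : Matrix (Bits n) (Bits n) ℂ} (hA : IsBlockEncoding 1 U A)
    (D : SVD A) {d : ℕ} {ψ : ℕ → ℝ} {P : ℝ[X]}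
    (hψ : ∀ x : ℝ, (qspPair ψ d).1.eval (x : ℂ) + (qspPair (-ψ) d).1.eval (x : ℂ) =
      2 * ((P.eval x : ℝ) : ℂ)) :
    IsBlockEncoding 1 ((qsvt (fun j : Fin (d + 1) => ψ (d - j))).unitary U)
      ((if Even d then D.V else D.W) * diagonal (fun i => ((P.eval (D.σ i) : ℝ) : ℂ)) * D.Vᴴ) := by
  obtain ⟨hU, hA⟩ := hA
  refine ⟨unitary_mem hU _, ?_⟩
  have hA' : A = (zeroIsometry m n)ᴴ * U * zeroIsometry m n := by
    rw [← block_eq]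
    simpa using hA
  have hblock : ∀ χ : ℕ → ℝ, of (fun i j : Bits n =>
      alternating (zeroProjector m n) U χ d (0, i) (0, j)) = (if Even d then D.V else D.W) *
        diagonal (fun i => (qspPair χ d).1.eval (D.σ i : ℂ)) * D.Vᴴ := fun χ => by
    rw [block_eq, ← zeroIsometry_mul_conjTranspose,
      block_alternating hU (zeroIsometry_isometry m n) hA' D]
  have hsum : diagonal (fun i => ((P.eval (D.σ i) : ℝ) : ℂ)) = (1 / 2 : ℂ) •
      (diagonal (fun i => (qspPair ψ d).1.eval (D.σ i : ℂ)) +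
        diagonal (fun i => (qspPair (-ψ) d).1.eval (D.σ i : ℂ))) := by
    rw [diagonal_add, ← diagonal_smul]
    congr 1
    funext i
    simp only [Pi.smul_apply, hψ, smul_eq_mul]
    ring
  rw [hsum, Matrix.mul_smul, Matrix.smul_mul, Matrix.mul_add, Matrix.add_mul, ← hblock, ← hblock]
  ext i j
  simp only [Matrix.smul_apply, Matrix.add_apply, of_apply, block_qsvt, smul_eq_mul,
    Complex.ofReal_one, one_mul]
  ring

end Circuit

end QSVT

theorem mainTheorem2 :
    ∃ C : ℝ, ∀ (n m : ℕ) (A : Matrix (QSVT.Bits n) (QSVT.Bits n) ℂ)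
      (U : Matrix (QSVT.Bits m × QSVT.Bits n) (QSVT.Bits m × QSVT.Bits n) ℂ),
      QSVT.IsBlockEncoding 1 U A →
      ∀ (d : ℕ) (P : Polynomial ℝ), 0 < d → P.natDegree = d →
      (∀ x : ℝ, P.eval (-x) = (-1) ^ d * P.eval x) →
      (∀ x ∈ Set.Icc (-1 : ℝ) 1, |P.eval x| ≤ 1) →
      ∃ Φ : Fin (d + 1) → ℝ,
        (Odd d → ∀ D : QSVT.SVD A,
          QSVT.IsBlockEncoding 1 ((QSVT.Circuit.qsvt Φ).unitary U)
            (D.diamond (fun x => ((P.eval x : ℝ) : ℂ)))) ∧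
        (Even d → ∀ D : QSVT.SVD A,
          QSVT.IsBlockEncoding 1 ((QSVT.Circuit.qsvt Φ).unitary U)
            (D.right (fun x => ((P.eval x : ℝ) : ℂ)))) ∧
        ((QSVT.Circuit.qsvt Φ).gateCount : ℝ) ≤ C * d := by
  -- The gate count is 4d + 5 (three per controlled rotation, d uses of U_A or U_A†, two Hadamard
  -- gates), at most 9d as d ≥ 1.
  refine ⟨9, fun n m A U hA d P hd hdeg hpar hP => ?_⟩
  have hpar' : P.comp (-Polynomial.X) = (-1) ^ d * P :=
    Polynomial.funext fun x => by simpa using hpar x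
  -- The phases depend on P alone, so they serve every singular value decomposition.
  obtain ⟨ψ, hψ⟩ := QSVT.exists_phases_real hd hdeg hpar' hP
  refine ⟨fun j => ψ (d - j), fun hodd D => ?_, fun heven D => ?_, ?_⟩
  · have h := QSVT.Circuit.qsvt_isBlockEncoding hA D hψ
    rwa [if_neg (Nat.not_even_iff_odd.2 hodd)] at h
  · have h := QSVT.Circuit.qsvt_isBlockEncoding hA D hψ
    rwa [if_pos heven] at h
  · rw [QSVT.Circuit.gateCount_qsvt]
    have : (1 : ℝ) ≤ d := by exact_mod_cast hd
    push_cast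
    linarith
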